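/- All rings are unital and all ring homomorphisms preserve the unit. A pair $(A,I)$ is a (not necessarily commutative) ring $A$ with a two-sided ideal $I$; a morphism $\phi:(A,I)\to(B,J)$ is a ring homomorphism $\phi:A\to B$ with $\phi^{-1}(J)=I$. Put $I^{(1)}=I$ and let $I^{(n+1)}$ be the ideal generated by all $as-sa$ with $a\in A$, $s\in I^{(n)}$; the pair $(A,I)$ is perfect if $\bigcap_{n\ge 1} I^{(n)}=0$. The pair $(A,I)$ is left (resp. right) Henselian if $I$ is contained in the Jacobson radical of $A$ and, for every monic $F\in A[x]$ ($x$ a central variable) and every factorization $\bar F=f_1f_2$ with $f_1,f_2\in (A/I)[x]$ monic and left coprime, i.e. $(A/I)[x]f_1+(A/I)[x]f_2=(A/I)[x]$ (resp. right coprime, i.e. $f_1(A/I)[x]+f_2(A/I)[x]=(A/I)[x]$), there are unique monic $F_1,F_2\in A[x]$ with $F=F_1F_2$, $\bar F_1=f_1$, $\bar F_2=f_2$. It is Henselian if it is both left and right Henselian. A left Henselization of $(A,I)$ is a morphism $\phi^{lh}:(A,I)\to(A^{lh},I^{lh})$ to a perfect left Henselian pair such that every morphism from $(A,I)$ to a perfect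 left Henselian pair factors as $\psi\circ\phi^{lh}$ for a unique morphism of pairs $\psi$. If $A$ is commutative, a commutative Henselization of $(A,I)$ is a morphism from $(A,I)$ to a Henselian pair with commutative underlying ring such that every morphism from $(A,I)$ to a Henselian pair with commutative underlying ring factors through it by a unique morphism of pairs. Proposition. Let $(A,I)$ be a pair with $A$ commutative. Then $(A,I)$ has a left Henselization. For every left Henselization $\phi^{lh}:(A,I)\to(A^{lh},I^{lh})$, the two-sided ideal $J$ of $A^{lh}$ generated by all commutators $ab-ba$ ($a,b\in A^{lh}$) is contained in $I^{lh}$. Moreover, the quotient map $q$ is a morphism of pairs $(A^{lh},I^{lh})\to(A^{lh}/J,I^{lh}/J)$, and the composite $$q\circ\phi^{lh}:(A,I)\to(A^{lh}/J,\,I^{lh}/J)$$ is the commutative Henselization of $(A,I)$. -/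

import Mathlib

open Polynomial

universe u v

/-! Pairs `(A, I)`: a ring `A` (unital, possibly noncommutative) with a two-sided ideal `I`,
given as `I : Ideal A` with `[I.IsTwoSided]`. -/

/-- `φ` is a morphism of pairs `(A, I) → (B, J)`: a ring homomorphism with `φ⁻¹(J) = I`. -/
def IsPairHom {A : Type u} {B : Type v} [Ring A] [Ring B] (I : Ideal A) (J : Ideal B)
    (φ : A →+* B) : Prop :=
  J.comap φ = I

/-- The two-sided ideal generated by a subset. -/
def twoSidedSpan {A : Type u} [Ring A] (S : Set A) : Ideal A :=
  (TwoSidedIdeal.span S).asIdeal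

instance twoSidedSpan_isTwoSided {A : Type u} [Ring A] (S : Set A) :
    (twoSidedSpan S).IsTwoSided :=
  inferInstanceAs ((TwoSidedIdeal.span S).asIdeal).IsTwoSided

/-- The set `[S, T]` of all commutators `s t - t s`. -/
def ringCommutatorSet {A : Type u} [Ring A] (S T : Set A) : Set A :=
  {c | ∃ s ∈ S, ∃ t ∈ T, c = s * t - t * s}

/-- The commutator filtration, indexed from `0`: the value at `n` is `I⁽ⁿ⁺¹⁾`, so `I⁽¹⁾ = I` and
`I⁽ⁿ⁺¹⁾` is the two-sided ideal generated by `[A, I⁽ⁿ⁾]`. -/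
def commutatorFiltration {A : Type u} [Ring A] (I : Ideal A) : ℕ → Ideal A
  | 0 => I
  | n + 1 => twoSidedSpan (ringCommutatorSet Set.univ (commutatorFiltration I n : Set A))

/-- `(A, I)` is perfect: separated with respect to its commutator filtration. -/
def IsPerfectPair {A : Type u} [Ring A] (I : Ideal A) : Prop :=
  ⨅ n, commutatorFiltration I n = ⊥

/-- `(A, I)` is a Jacobson pair. -/
def IsJacobsonPair {A : Type u} [Ring A] (I : Ideal A) : Prop :=
  I ≤ Ring.jacobson A

/-- `A[x] F₁ + A[x] F₂ = A[x]`. -/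
def IsLeftCoprime {A : Type u} [Ring A] (F₁ F₂ : A[X]) : Prop :=
  ∃ G₁ G₂ : A[X], G₁ * F₁ + G₂ * F₂ = 1

/-- `F₁ A[x] + F₂ A[x] = A[x]`. -/
def IsRightCoprime {A : Type u} [Ring A] (F₁ F₂ : A[X]) : Prop :=
  ∃ G₁ G₂ : A[X], F₁ * G₁ + F₂ * G₂ = 1

/-- `F = F₁ F₂` with `F₁, F₂` monic lifts of `f₁, f₂`. -/
def IsMonicLift {A : Type u} [Ring A] (I : Ideal A) [I.IsTwoSided] (F : A[X]) (f₁ f₂ : (A ⧸ I)[X])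
    (F₁ F₂ : A[X]) : Prop :=
  F₁.Monic ∧ F₂.Monic ∧ F = F₁ * F₂ ∧
    F₁.map (Ideal.Quotient.mk I) = f₁ ∧ F₂.map (Ideal.Quotient.mk I) = f₂

structure IsLeftHenselian {A : Type u} [Ring A] (I : Ideal A) [I.IsTwoSided] : Prop where
  jacobson : IsJacobsonPair I
  lift : ∀ F : A[X], F.Monic → ∀ f₁ f₂ : (A ⧸ I)[X], f₁.Monic → f₂.Monic →
    IsLeftCoprime f₁ f₂ → F.map (Ideal.Quotient.mk I) = f₁ * f₂ →
    ∃! P : A[X] × A[X], IsMonicLift I F f₁ f₂ P.1 P.2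

structure IsRightHenselian {A : Type u} [Ring A] (I : Ideal A) [I.IsTwoSided] : Prop where
  jacobson : IsJacobsonPair I
  lift : ∀ F : A[X], F.Monic → ∀ f₁ f₂ : (A ⧸ I)[X], f₁.Monic → f₂.Monic →
    IsRightCoprime f₁ f₂ → F.map (Ideal.Quotient.mk I) = f₁ * f₂ →
    ∃! P : A[X] × A[X], IsMonicLift I F f₁ f₂ P.1 P.2

/-- A Henselian pair: left and right Henselian. -/
def IsHenselian {A : Type u} [Ring A] (I : Ideal A) [I.IsTwoSided] : Prop :=
  IsLeftHenselian I ∧ IsRightHenselian I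

/-- `φ : (A, I) → (H, K)` is a left Henselization of `(A, I)` in the category of perfect pairs:
`(H, K)` is perfect and left Henselian, and `φ` is universal among the morphisms of pairs from
`(A, I)` to perfect left Henselian pairs. -/
structure IsLeftHenselization {A H : Type u} [Ring A] [Ring H] (I : Ideal A) (K : Ideal H)
    [K.IsTwoSided] (φ : A →+* H) : Prop where
  perfect : IsPerfectPair K
  henselian : IsLeftHenselian K
  hom : IsPairHom I K φ
  universal : ∀ (B : Type u) [Ring B] (L : Ideal B) [L.IsTwoSided] (f : A →+* B),
    IsPerfectPair L → IsLeftHenselian L → IsPairHom I L f →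
    ∃! ψ : H →+* B, IsPairHom K L ψ ∧ f = ψ.comp φ

/-- `φ : (A, I) → (H, K)` is a Henselization of `(A, I)` in the category of commutative pairs:
`(H, K)` is commutative and Henselian, and `φ` is universal among the morphisms of pairs from
`(A, I)` to commutative Henselian pairs. -/
structure IsCommutativeHenselization {A H : Type u} [Ring A] [Ring H] (I : Ideal A) (K : Ideal H)
    [K.IsTwoSided] (φ : A →+* H) : Prop where
  comm : ∀ x y : H, x * y = y * x
  henselian : IsHenselian K
  hom : IsPairHom I K φ
  universal : ∀ (B : Type u) [CommRing B] (L : Ideal B) (f : A →+* B),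
    IsHenselian L → IsPairHom I L f →
    ∃! ψ : H →+* B, IsPairHom K L ψ ∧ f = ψ.comp φ

/-- The two-sided ideal generated by `[A, A]`. -/
def commutatorIdeal (A : Type u) [Ring A] : Ideal A :=
  twoSidedSpan (ringCommutatorSet (Set.univ : Set A) Set.univ)

instance commutatorIdeal_isTwoSided (A : Type u) [Ring A] : (commutatorIdeal A).IsTwoSided :=
  inferInstanceAs (twoSidedSpan _).IsTwoSided

/-- The ideal `(K + J) / J` of `H / J`; it is `K / J` when `J ≤ K`. -/
def quotientIdeal {H : Type u} [Ring H] (K J : Ideal H) [J.IsTwoSided] : Ideal (H ⧸ J) :=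
  K.map (Ideal.Quotient.mk J)

instance quotientIdeal_isTwoSided {H : Type u} [Ring H] (K J : Ideal H) [J.IsTwoSided]
    [K.IsTwoSided] : (quotientIdeal K J).IsTwoSided := by
  refine ⟨fun {a} b ha => ?_⟩
  have hs : Function.Surjective (Ideal.Quotient.mk J) := Ideal.Quotient.mk_surjective
  obtain ⟨x, hx, rfl⟩ := (Ideal.mem_map_iff_of_surjective _ hs).1 ha
  obtain ⟨y, rfl⟩ := hs b
  rw [← map_mul]
  exact Ideal.mem_map_of_mem _ (K.mul_mem_right y hx)

-- Existence is a solution-set argument. Take the fibre product over `A ⧸ I` of all perfect left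
-- Henselian pairs under `(A, I)`. Inverses and factorizations formed componentwise have common
-- residues, so they stay in it, and it is itself perfect and left Henselian. It lives one universe
-- too high, but its residue ring is a quotient of `A`. Since lifts are unique, each is determined
-- by small data, so the smallest lift closed subring containing the image of `A` is small. The
-- projections give the universal maps; they are unique because the locus where two such maps agree
-- is lift closed (`IsPairHom.eq_of_comp_eq`).
--
-- For the comparison, `(A ⧸ I, 0)` is a commutative test pair, and its universal map sends
-- commutators to `0`; they therefore lie in the ideal of the Henselization. Factorizations still
-- lift after dividing by them, and over a commutative ring uniqueness is automatic by a resultant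
-- argument. Commutative Henselian pairs are perfect and left Henselian, so the universal property
-- passes to the quotient.

universe w

/-! ### Morphisms of pairs and Jacobson pairs -/

/-- The ring homomorphism `A ⧸ I →+* B ⧸ J` induced by a morphism of pairs. -/
def IsPairHom.residueMap {A : Type u} {B : Type v} [Ring A] [Ring B] {I : Ideal A} {J : Ideal B}
    [I.IsTwoSided] [J.IsTwoSided] {φ : A →+* B} (h : IsPairHom I J φ) : A ⧸ I →+* B ⧸ J :=
  Ideal.quotientMap J φ (le_of_eq h.symm)

namespace IsPairHom

variable {A : Type u} {B : Type v} [Ring A] [Ring B] {I : Ideal A} {J : Ideal B} {φ : A →+* B}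

theorem mem_iff (h : IsPairHom I J φ) {a : A} : φ a ∈ J ↔ a ∈ I := by
  rw [← Ideal.mem_comap, h]

theorem comp {C : Type w} [Ring C] {L : Ideal C} {ψ : B →+* C} (hψ : IsPairHom J L ψ)
    (hφ : IsPairHom I J φ) : IsPairHom I L (ψ.comp φ) := by
  rw [IsPairHom, ← Ideal.comap_comap, hψ, hφ]

variable [I.IsTwoSided] [J.IsTwoSided]

@[simp]
theorem residueMap_mk (h : IsPairHom I J φ) (a : A) :
    h.residueMap (Ideal.Quotient.mk I a) = Ideal.Quotient.mk J (φ a) :=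
  rfl

theorem residueMap_comp_mk (h : IsPairHom I J φ) :
    h.residueMap.comp (Ideal.Quotient.mk I) = (Ideal.Quotient.mk J).comp φ :=
  rfl

theorem residueMap_injective (h : IsPairHom I J φ) : Function.Injective h.residueMap :=
  Ideal.quotientMap_injective' (le_of_eq h)

theorem map_residueMap (h : IsPairHom I J φ) (F : A[X]) :
    (F.map (Ideal.Quotient.mk I)).map h.residueMap = (F.map φ).map (Ideal.Quotient.mk J) := by
  rw [Polynomial.map_map, Polynomial.map_map, residueMap_comp_mk]

end IsPairHom

theorem IsLeftCoprime.map {A : Type u} {B : Type v} [Ring A] [Ring B] {f g : A[X]}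
    (h : IsLeftCoprime f g) (φ : A →+* B) : IsLeftCoprime (f.map φ) (g.map φ) := by
  obtain ⟨a, b, hab⟩ := h
  refine ⟨a.map φ, b.map φ, ?_⟩
  rw [← Polynomial.map_mul, ← Polynomial.map_mul, ← Polynomial.map_add, hab, Polynomial.map_one]

theorem mem_jacobson_iff_exists {A : Type u} [Ring A] {x : A} :
    x ∈ Ring.jacobson A ↔ ∀ y, ∃ z, z * (1 + y * x) = 1 := by
  rw [← Ideal.jacobson_bot, Ideal.mem_jacobson_iff]
  refine forall_congr' fun y => exists_congr fun z => ?_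
  rw [Ideal.mem_bot, sub_eq_zero, mul_add, mul_one, ← mul_assoc, add_comm]

theorem isJacobsonPair_iff {A : Type u} [Ring A] {I : Ideal A} :
    IsJacobsonPair I ↔ ∀ x ∈ I, ∃ z, z * (1 + x) = 1 := by
  refine ⟨fun h x hx => ?_, fun h x hx =>
    mem_jacobson_iff_exists.2 fun y => h _ (I.mul_mem_left y hx)⟩
  simpa using mem_jacobson_iff_exists.1 (h hx) 1

/-- Since `z = 1 - z * x` lies in `1 + I`, it has a left inverse too, which must be `1 + x`; so `z`
is a two-sided inverse. -/
theorem IsJacobsonPair.eq_of_mul_eq_one {A : Type u} [Ring A] {I : Ideal A} (h : IsJacobsonPair I)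
    {x z z' : A} (hx : x ∈ I) (hz : z * (1 + x) = 1) (hz' : z' * (1 + x) = 1) : z = z' := by
  obtain ⟨w, hw⟩ := isJacobsonPair_iff.1 h (-(z * x)) (I.neg_mem (I.mul_mem_left z hx))
  have hz1 : 1 + -(z * x) = z := by rw [← hz]; noncomm_ring
  rw [hz1] at hw
  have hw1 : w = 1 + x := by
    calc w = w * (z * (1 + x)) := by rw [hz, mul_one]
      _ = 1 + x := by rw [← mul_assoc, hw, one_mul]
  rw [hw1] at hw
  calc z = z' * (1 + x) * z := by rw [hz', one_mul]
    _ = z' := by rw [mul_assoc, hw, mul_one]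

theorem IsJacobsonPair.subsingleton {A : Type u} [Ring A] {I : Ideal A} (h : IsJacobsonPair I)
    (hI : (1 : A) ∈ I) : Subsingleton A := by
  obtain ⟨z, hz⟩ := isJacobsonPair_iff.1 h (-1) (I.neg_mem hI)
  rw [add_neg_cancel, mul_zero] at hz
  exact subsingleton_of_zero_eq_one hz

/-- A monic polynomial has the degree of any of its reductions modulo an ideal contained in the
Jacobson radical. -/
theorem IsJacobsonPair.natDegree_map_mk {A : Type u} [Ring A] {I : Ideal A} [I.IsTwoSided]
    (h : IsJacobsonPair I) {F : A[X]} (hF : F.Monic) :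
    (F.map (Ideal.Quotient.mk I)).natDegree = F.natDegree := by
  by_cases hI : (1 : A) ∈ I
  · have := h.subsingleton hI
    rw [Subsingleton.elim F 0]; simp
  · have : Nontrivial (A ⧸ I) :=
      Ideal.Quotient.nontrivial_iff.2 fun h => hI (h ▸ Submodule.mem_top)
    exact hF.natDegree_map _

theorem IsMonicLift.map {A : Type u} {B : Type v} [Ring A] [Ring B] {I : Ideal A} {J : Ideal B}
    [I.IsTwoSided] [J.IsTwoSided] {φ : A →+* B} (h : IsPairHom I J φ) {F F₁ F₂ : A[X]}
    {f₁ f₂ : (A ⧸ I)[X]} (hF : IsMonicLift I F f₁ f₂ F₁ F₂) :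
    IsMonicLift J (F.map φ) (f₁.map h.residueMap) (f₂.map h.residueMap) (F₁.map φ) (F₂.map φ) := by
  obtain ⟨h1, h2, h3, h4, h5⟩ := hF
  refine ⟨h1.map _, h2.map _, by rw [h3, Polynomial.map_mul], ?_, ?_⟩
  · rw [← h.map_residueMap, h4]
  · rw [← h.map_residueMap, h5]

theorem IsLeftHenselian.existsUnique_isMonicLift_map {A : Type u} {B : Type v} [Ring A] [Ring B]
    {I : Ideal A} {J : Ideal B} [I.IsTwoSided] [J.IsTwoSided] {φ : A →+* B}
    (hJ : IsLeftHenselian J) (h : IsPairHom I J φ) {F : A[X]} {f₁ f₂ : (A ⧸ I)[X]} (hF : F.Monic)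
    (h₁ : f₁.Monic) (h₂ : f₂.Monic) (hc : IsLeftCoprime f₁ f₂)
    (hf : F.map (Ideal.Quotient.mk I) = f₁ * f₂) :
    ∃! P : B[X] × B[X],
      IsMonicLift J (F.map φ) (f₁.map h.residueMap) (f₂.map h.residueMap) P.1 P.2 :=
  hJ.lift _ (hF.map _) _ _ (h₁.map _) (h₂.map _) (hc.map _)
    (by rw [← h.map_residueMap, hf, Polynomial.map_mul])

/-! ### Descent along jointly injective families -/

section Family

variable {ι : Type w} {R : Type u} {B : ι → Type v} [Ring R] [∀ c, Ring (B c)] {M : Ideal R}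
  {L : ∀ c, Ideal (B c)} {g : ∀ c, R →+* B c}

theorem map_injective_of_jointly_injective
    (hinj : ∀ x y, (∀ c, g c x = g c y) → x = y) {F G : R[X]}
    (h : ∀ c, F.map (g c) = G.map (g c)) : F = G := by
  ext n
  exact hinj _ _ fun c => by rw [← Polynomial.coeff_map, h c, Polynomial.coeff_map]

variable [M.IsTwoSided] [∀ c, (L c).IsTwoSided]

/-- The reduction `f` supplies a degree common to all components: each has the degree of `f`, unless
`L c` is the whole ring, and then `B c` is zero. -/
theorem monic_of_jointly_injective (hg : ∀ c, IsPairHom M (L c) (g c))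
    (hinj : ∀ x y, (∀ c, g c x = g c y) → x = y) (hL : ∀ c, IsJacobsonPair (L c)) {G : R[X]}
    {f : (R ⧸ M)[X]} (hf : f.Monic) (hG : ∀ c, (G.map (g c)).Monic)
    (hGf : ∀ c, (G.map (g c)).map (Ideal.Quotient.mk (L c)) = f.map (hg c).residueMap) :
    G.Monic := by
  have hd : ∀ c, (G.map (g c)).natDegree ≤ f.natDegree := fun c => by
    rw [← (hL c).natDegree_map_mk (hG c), hGf c]
    exact natDegree_map_le
  have hd' : ∀ c, (G.map (g c)).coeff f.natDegree = 1 := fun c => by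
    by_cases h1 : (1 : B c) ∈ L c
    · have := (hL c).subsingleton h1
      exact Subsingleton.elim _ _
    · have : Nontrivial (B c ⧸ L c) :=
        Ideal.Quotient.nontrivial_iff.2 fun h => h1 (h ▸ Submodule.mem_top)
      have hn : f.natDegree = (G.map (g c)).natDegree := by
        rw [← (hL c).natDegree_map_mk (hG c), hGf c, hf.natDegree_map]
      rw [hn]
      exact hG c
  refine monic_of_natDegree_le_of_coeff_eq_one f.natDegree ?_ ?_
  · refine natDegree_le_iff_coeff_eq_zero.2 fun N hN => hinj _ _ fun c => ?_
    rw [← Polynomial.coeff_map, map_zero]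
    exact coeff_eq_zero_of_natDegree_lt ((hd c).trans_lt hN)
  · exact hinj _ _ fun c => by rw [← Polynomial.coeff_map, hd' c, map_one]

/-- A pair with a jointly injective family of morphisms to left Henselian pairs is left Henselian
as soon as inverses and factorizations descend. -/
theorem IsLeftHenselian.of_jointly_injective [Nonempty ι] (hg : ∀ c, IsPairHom M (L c) (g c))
    (hinj : ∀ x y, (∀ c, g c x = g c y) → x = y) (hL : ∀ c, IsLeftHenselian (L c))
    (hM : IsJacobsonPair M)
    (hlift : ∀ F : R[X], F.Monic → ∀ f₁ f₂ : (R ⧸ M)[X], f₁.Monic → f₂.Monic →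
      IsLeftCoprime f₁ f₂ → F.map (Ideal.Quotient.mk M) = f₁ * f₂ →
      ∃ G₁ G₂ : R[X], ∀ c, IsMonicLift (L c) (F.map (g c)) (f₁.map (hg c).residueMap)
        (f₂.map (hg c).residueMap) (G₁.map (g c)) (G₂.map (g c))) :
    IsLeftHenselian M := by
  refine ⟨hM, fun F hF f₁ f₂ h₁ h₂ hc hf => ?_⟩
  obtain ⟨G₁, G₂, hG⟩ := hlift F hF f₁ f₂ h₁ h₂ hc hf
  obtain ⟨c₀⟩ := ‹Nonempty ι›
  refine ⟨(G₁, G₂), ⟨?_, ?_, ?_, ?_, ?_⟩, ?_⟩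
  · exact monic_of_jointly_injective hg hinj (fun c => (hL c).jacobson) h₁
      (fun c => (hG c).1) fun c => (hG c).2.2.2.1
  · exact monic_of_jointly_injective hg hinj (fun c => (hL c).jacobson) h₂
      (fun c => (hG c).2.1) fun c => (hG c).2.2.2.2
  · refine map_injective_of_jointly_injective hinj fun c => ?_
    rw [(hG c).2.2.1, Polynomial.map_mul]
  -- One component suffices, because the residue map of a morphism of pairs is injective.
  · apply Polynomial.map_injective _ (hg c₀).residueMap_injective
    rw [(hg c₀).map_residueMap, (hG c₀).2.2.2.1]
  · apply Polynomial.map_injective _ (hg c₀).residueMap_injective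
    rw [(hg c₀).map_residueMap, (hG c₀).2.2.2.2]
  · rintro ⟨P₁, P₂⟩ hP
    have key : ∀ c, (P₁.map (g c), P₂.map (g c)) = (G₁.map (g c), G₂.map (g c)) := fun c =>
      ((hL c).existsUnique_isMonicLift_map (hg c) hF h₁ h₂ hc hf).unique (hP.map (hg c)) (hG c)
    exact Prod.ext
      (map_injective_of_jointly_injective hinj fun c => congrArg Prod.fst (key c))
      (map_injective_of_jointly_injective hinj fun c => congrArg Prod.snd (key c))

end Family

/-! ### Perfect pairs and basic examples -/

theorem map_mem_commutatorFiltration {A : Type u} {B : Type v} [Ring A] [Ring B] {I : Ideal A}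
    {J : Ideal B} {φ : A →+* B} (h : ∀ x ∈ I, φ x ∈ J) (n : ℕ) :
    ∀ x ∈ commutatorFiltration I n, φ x ∈ commutatorFiltration J n := by
  induction n with
  | zero => exact h
  | succ n ih =>
    intro x hx
    have hle : TwoSidedIdeal.span
        (ringCommutatorSet Set.univ (commutatorFiltration I n : Set A)) ≤
        (TwoSidedIdeal.span
          (ringCommutatorSet Set.univ (commutatorFiltration J n : Set B))).comap φ := by
      rw [TwoSidedIdeal.span_le]
      rintro _ ⟨s, -, t, ht, rfl⟩
      rw [SetLike.mem_coe, TwoSidedIdeal.mem_comap]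
      refine TwoSidedIdeal.subset_span ⟨φ s, trivial, φ t, ih t ht, ?_⟩
      rw [map_sub, map_mul, map_mul]
    exact TwoSidedIdeal.mem_asIdeal.2
      ((TwoSidedIdeal.mem_comap _).1 (hle (TwoSidedIdeal.mem_asIdeal.1 hx)))

theorem IsPerfectPair.of_jointly_injective {ι : Type w} {R : Type u} {B : ι → Type v} [Ring R]
    [∀ c, Ring (B c)] {M : Ideal R} {L : ∀ c, Ideal (B c)} {g : ∀ c, R →+* B c}
    (hg : ∀ c, IsPairHom M (L c) (g c)) (hinj : ∀ x y, (∀ c, g c x = g c y) → x = y)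
    (hL : ∀ c, IsPerfectPair (L c)) : IsPerfectPair M := by
  refine eq_bot_iff.2 fun x hx => (Submodule.mem_bot R).2 (hinj x 0 fun c => ?_)
  rw [map_zero, ← Submodule.mem_bot (B c), ← hL c, Ideal.mem_iInf]
  exact fun n => map_mem_commutatorFiltration (fun y hy => (hg c).mem_iff.2 hy) n x
    (Ideal.mem_iInf.1 hx n)

theorem commutatorIdeal_le_iff {A : Type u} [Ring A] {K : Ideal A} [K.IsTwoSided] :
    commutatorIdeal A ≤ K ↔ ∀ x y : A, x * y - y * x ∈ K := by
  constructor
  · exact fun h x y => h (TwoSidedIdeal.mem_asIdeal.2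
      (TwoSidedIdeal.subset_span ⟨x, trivial, y, trivial, rfl⟩))
  · intro h x hx
    have : TwoSidedIdeal.span (ringCommutatorSet (Set.univ : Set A) Set.univ) ≤
        K.toTwoSided := by
      rw [TwoSidedIdeal.span_le]
      rintro _ ⟨s, -, t, -, rfl⟩
      simpa using h s t
    simpa using this (TwoSidedIdeal.mem_asIdeal.1 hx)

theorem isPerfectPair_of_comm {A : Type u} [Ring A] (h : ∀ x y : A, x * y = y * x)
    (I : Ideal A) : IsPerfectPair I := by
  have h1 : commutatorIdeal A ≤ ⊥ := commutatorIdeal_le_iff.2 fun x y => by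
    rw [h x y, sub_self]; exact Submodule.zero_mem _
  -- Index `1` is `I⁽²⁾`, which is generated by commutators and so already vanishes.
  refine eq_bot_iff.2 ((iInf_le _ 1).trans (le_trans ?_ h1))
  intro x hx
  refine TwoSidedIdeal.mem_asIdeal.2 (TwoSidedIdeal.span_mono ?_ (TwoSidedIdeal.mem_asIdeal.1 hx))
  rintro _ ⟨s, hs, t, -, rfl⟩
  exact ⟨s, hs, t, trivial, rfl⟩

/-- Provides the test pair `(A ⧸ I, 0)`. -/
theorem isLeftHenselian_bot (A : Type u) [Ring A] : IsLeftHenselian (⊥ : Ideal A) := by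
  have hinj : Function.Injective (Ideal.Quotient.mk (⊥ : Ideal A)) := by
    rw [injective_iff_map_eq_zero]
    intro a ha
    simpa using Ideal.Quotient.eq_zero_iff_mem.1 ha
  have hmap := Polynomial.map_injective _ hinj
  refine ⟨bot_le, fun F hF f₁ f₂ h₁ h₂ _ hf => ?_⟩
  obtain ⟨F₁, rfl⟩ := Polynomial.map_surjective _ Ideal.Quotient.mk_surjective f₁
  obtain ⟨F₂, rfl⟩ := Polynomial.map_surjective _ Ideal.Quotient.mk_surjective f₂
  refine ⟨(F₁, F₂), ⟨Polynomial.monic_of_injective hinj h₁, Polynomial.monic_of_injective hinj h₂,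
    hmap (by rw [hf, Polynomial.map_mul]), rfl, rfl⟩, ?_⟩
  rintro ⟨P₁, P₂⟩ ⟨-, -, -, h4, h5⟩
  exact Prod.ext (hmap h4) (hmap h5)

/-! ### Commutative Henselian pairs -/

theorem isRightCoprime_iff_isCoprime {A : Type u} [CommRing A] {f g : A[X]} :
    IsRightCoprime f g ↔ IsCoprime f g := by
  simp only [IsRightCoprime, IsCoprime, mul_comm]

theorem IsJacobsonPair.isUnit_of_isUnit_mk {A : Type u} [CommRing A] {I : Ideal A}
    (h : IsJacobsonPair I) {a : A} (ha : IsUnit (Ideal.Quotient.mk I a)) : IsUnit a := by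
  obtain ⟨b, hb⟩ := ha.exists_right_inv
  obtain ⟨b, rfl⟩ := Ideal.Quotient.mk_surjective b
  rw [← map_mul, ← map_one (Ideal.Quotient.mk I), Ideal.Quotient.eq] at hb
  obtain ⟨z, hz⟩ := isJacobsonPair_iff.1 h _ hb
  refine IsUnit.of_mul_eq_one (b * z) ?_
  rw [← hz]; ring

/-- Coprimality of monic polynomials lifts modulo an ideal contained in the Jacobson radical. -/
theorem IsJacobsonPair.isCoprime_of_map {A : Type u} [CommRing A] {I : Ideal A}
    (h : IsJacobsonPair I) {F G : A[X]} (hF : F.Monic) (hG : G.Monic)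
    (hc : IsCoprime (F.map (Ideal.Quotient.mk I)) (G.map (Ideal.Quotient.mk I))) :
    IsCoprime F G := by
  -- The resultant commutes with reduction because the degrees are preserved, and units are detected
  -- modulo the ideal.
  rw [← isUnit_resultant_iff_isCoprime hF]
  apply h.isUnit_of_isUnit_mk
  rw [← resultant_map_map, ← h.natDegree_map_mk hF, ← h.natDegree_map_mk hG]
  exact (isUnit_resultant_iff_isCoprime (hF.map _)).2 hc

/-- `F₁` is coprime to `G₂`, since their reductions are, and divides `G₁ * G₂`; so it divides `G₁`,
which is monic of the same degree. -/
theorem IsJacobsonPair.isMonicLift_unique {A : Type u} [CommRing A] {I : Ideal A}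
    (h : IsJacobsonPair I) {F F₁ F₂ G₁ G₂ : A[X]} {f₁ f₂ : (A ⧸ I)[X]} (hc : IsCoprime f₁ f₂)
    (hF : IsMonicLift I F f₁ f₂ F₁ F₂) (hG : IsMonicLift I F f₁ f₂ G₁ G₂) :
    F₁ = G₁ ∧ F₂ = G₂ := by
  obtain ⟨m₁, m₂, hF, r₁, r₂⟩ := hF
  obtain ⟨n₁, n₂, hG, s₁, s₂⟩ := hG
  have hcop : IsCoprime F₁ G₂ := h.isCoprime_of_map m₁ n₂ (by rwa [r₁, s₂])
  have hdvd : F₁ ∣ G₁ := hcop.dvd_of_dvd_mul_right (hG ▸ hF ▸ dvd_mul_right _ _)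
  have hdeg : G₁.natDegree ≤ F₁.natDegree := by
    rw [← h.natDegree_map_mk m₁, ← h.natDegree_map_mk n₁, r₁, s₁]
  have h₁ : F₁ = G₁ := (eq_of_monic_of_dvd_of_natDegree_le m₁ n₁ hdvd hdeg).symm
  refine ⟨h₁, m₁.isRegular.left ?_⟩
  change F₁ * F₂ = F₁ * G₂
  rw [← hF, hG, h₁]

theorem isHenselian_of_exists_isMonicLift {A : Type u} [CommRing A] {I : Ideal A}
    (h : IsJacobsonPair I)
    (hlift : ∀ F : A[X], F.Monic → ∀ f₁ f₂ : (A ⧸ I)[X], f₁.Monic → f₂.Monic →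
      IsLeftCoprime f₁ f₂ → F.map (Ideal.Quotient.mk I) = f₁ * f₂ →
      ∃ F₁ F₂, IsMonicLift I F f₁ f₂ F₁ F₂) : IsHenselian I := by
  have key : ∀ F : A[X], F.Monic → ∀ f₁ f₂ : (A ⧸ I)[X], f₁.Monic → f₂.Monic →
      IsCoprime f₁ f₂ → F.map (Ideal.Quotient.mk I) = f₁ * f₂ →
      ∃! P : A[X] × A[X], IsMonicLift I F f₁ f₂ P.1 P.2 := by
    intro F hF f₁ f₂ h₁ h₂ hc hf
    obtain ⟨F₁, F₂, hF₁⟩ := hlift F hF f₁ f₂ h₁ h₂ hc hf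
    refine ⟨(F₁, F₂), hF₁, ?_⟩
    rintro ⟨P₁, P₂⟩ hP
    obtain ⟨e₁, e₂⟩ := h.isMonicLift_unique hc hP hF₁
    exact Prod.ext e₁ e₂
  exact ⟨⟨h, key⟩, ⟨h, fun F hF f₁ f₂ h₁ h₂ hc =>
    key F hF f₁ f₂ h₁ h₂ (isRightCoprime_iff_isCoprime.1 hc)⟩⟩

/-! ### Surjective images and the commutator quotient -/

theorem Polynomial.Monic.exists_monic_lift {A : Type u} {B : Type v} [Ring A] [Ring B]
    {φ : A →+* B} (hφ : Function.Surjective φ) {F : B[X]} (hF : F.Monic) :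
    ∃ G : A[X], G.Monic ∧ G.map φ = F := by
  obtain ⟨G, h1, -, h3⟩ := lifts_and_natDegree_eq_and_monic
    ((mem_lifts F).2 (Polynomial.map_surjective φ hφ F)) hF
  exact ⟨G, h3, h1⟩

theorem IsJacobsonPair.of_surjective {A : Type u} {B : Type v} [Ring A] [Ring B] {I : Ideal A}
    {J : Ideal B} {φ : A →+* B} (h : IsPairHom I J φ) (hφ : Function.Surjective φ)
    (hI : IsJacobsonPair I) : IsJacobsonPair J := by
  refine isJacobsonPair_iff.2 fun y hy => ?_
  obtain ⟨x, rfl⟩ := hφ y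
  obtain ⟨z, hz⟩ := isJacobsonPair_iff.1 hI x (h.mem_iff.1 hy)
  exact ⟨φ z, by rw [← map_one φ, ← map_add, ← map_mul, hz]⟩

/-- Factorizations lift in every surjective image of a left Henselian pair. -/
theorem IsLeftHenselian.exists_isMonicLift_of_surjective {A : Type u} {B : Type v} [Ring A]
    [Ring B] {I : Ideal A} {J : Ideal B} [I.IsTwoSided] [J.IsTwoSided] {φ : A →+* B}
    (h : IsPairHom I J φ) (hφ : Function.Surjective φ) (hI : IsLeftHenselian I) {F : B[X]}
    (hF : F.Monic) {f₁ f₂ : (B ⧸ J)[X]} (h₁ : f₁.Monic) (h₂ : f₂.Monic)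
    (hc : IsLeftCoprime f₁ f₂) (hf : F.map (Ideal.Quotient.mk J) = f₁ * f₂) :
    ∃ F₁ F₂, IsMonicLift J F f₁ f₂ F₁ F₂ := by
  obtain ⟨G, hG, rfl⟩ := hF.exists_monic_lift hφ
  -- A surjective morphism of pairs is an isomorphism on residue rings, so the factorization can be
  -- pulled back.
  let e : A ⧸ I ≃+* B ⧸ J := RingEquiv.ofBijective h.residueMap
    ⟨h.residueMap_injective, Ideal.quotientMap_surjective hφ⟩
  have he : h.residueMap.comp e.symm.toRingHom = RingHom.id _ :=
    RingHom.ext fun x => e.apply_symm_apply x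
  have hmap : ∀ f : (B ⧸ J)[X], (f.map e.symm.toRingHom).map h.residueMap = f := fun f => by
    rw [Polynomial.map_map, he, Polynomial.map_id]
  obtain ⟨⟨F₁, F₂⟩, hP, -⟩ := hI.lift G hG _ _ (h₁.map e.symm.toRingHom)
    (h₂.map e.symm.toRingHom) (hc.map _) (by
      apply Polynomial.map_injective _ h.residueMap_injective
      rw [h.map_residueMap, hf, Polynomial.map_mul, hmap, hmap])
  have := hP.map h
  rw [hmap, hmap] at this
  exact ⟨_, _, this⟩

theorem isPairHom_mk_quotientIdeal {A : Type u} [Ring A] {K J : Ideal A} [J.IsTwoSided]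
    (h : J ≤ K) : IsPairHom K (quotientIdeal K J) (Ideal.Quotient.mk J) := by
  rw [IsPairHom, quotientIdeal, Ideal.comap_map_of_surjective _ Ideal.Quotient.mk_surjective,
    ← RingHom.ker_eq_comap_bot, Ideal.mk_ker, sup_eq_left.2 h]

theorem quotient_commutatorIdeal_comm (A : Type u) [Ring A] (x y : A ⧸ commutatorIdeal A) :
    x * y = y * x := by
  obtain ⟨x, rfl⟩ := Ideal.Quotient.mk_surjective x
  obtain ⟨y, rfl⟩ := Ideal.Quotient.mk_surjective y
  rw [← map_mul, ← map_mul, Ideal.Quotient.eq]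
  exact commutatorIdeal_le_iff.1 le_rfl x y

theorem isPairHom_mk_bot {A : Type u} [Ring A] (I : Ideal A) [I.IsTwoSided] :
    IsPairHom I (⊥ : Ideal (A ⧸ I)) (Ideal.Quotient.mk I) := by
  rw [IsPairHom, ← RingHom.ker_eq_comap_bot, Ideal.mk_ker]

/-- The quotient of a left Henselian pair by the commutator ideal is Henselian. -/
theorem IsLeftHenselian.isHenselian_quotient_commutatorIdeal {H : Type u} [Ring H] {K : Ideal H}
    [K.IsTwoSided] (hK : IsLeftHenselian K) (h : commutatorIdeal H ≤ K) :
    IsHenselian (quotientIdeal K (commutatorIdeal H)) := by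
  have hπ := isPairHom_mk_quotientIdeal h
  have hs : Function.Surjective (Ideal.Quotient.mk (commutatorIdeal H)) :=
    Ideal.Quotient.mk_surjective
  let _ : CommRing (H ⧸ commutatorIdeal H) :=
    { (inferInstance : Ring (H ⧸ commutatorIdeal H)) with
      mul_comm := quotient_commutatorIdeal_comm H }
  exact isHenselian_of_exists_isMonicLift (hK.jacobson.of_surjective hπ hs)
    fun F hF f₁ f₂ h₁ h₂ hc hf => hK.exists_isMonicLift_of_surjective hπ hs hF h₁ h₂ hc hf

/-- The universal map to `(A ⧸ I, 0)` kills commutators, and its kernel is `K`. -/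
theorem IsLeftHenselization.commutatorIdeal_le {A H : Type u} [CommRing A] [Ring H] {I : Ideal A}
    {K : Ideal H} [K.IsTwoSided] {φ : A →+* H} (h : IsLeftHenselization I K φ) :
    commutatorIdeal H ≤ K := by
  obtain ⟨ψ, ⟨hψ, -⟩, -⟩ := h.universal (A ⧸ I) ⊥ (Ideal.Quotient.mk I)
    (isPerfectPair_of_comm mul_comm _) (isLeftHenselian_bot _) (isPairHom_mk_bot I)
  refine commutatorIdeal_le_iff.2 fun x y => hψ.mem_iff.1 ?_
  rw [map_sub, map_mul, map_mul, mul_comm, sub_self]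
  exact Submodule.zero_mem _

theorem IsLeftHenselization.isCommutativeHenselization {A H : Type u} [CommRing A] [Ring H]
    {I : Ideal A} {K : Ideal H} [K.IsTwoSided] {φ : A →+* H} (h : IsLeftHenselization I K φ) :
    IsCommutativeHenselization I (quotientIdeal K (commutatorIdeal H))
      ((Ideal.Quotient.mk (commutatorIdeal H)).comp φ) := by
  have hπ := isPairHom_mk_quotientIdeal h.commutatorIdeal_le
  refine ⟨quotient_commutatorIdeal_comm H,
    h.henselian.isHenselian_quotient_commutatorIdeal h.commutatorIdeal_le, hπ.comp h.hom, ?_⟩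
  intro B _ L f hL hf
  obtain ⟨ψ, ⟨hψ, rfl⟩, huniq⟩ := h.universal B L f (isPerfectPair_of_comm mul_comm _) hL.1 hf
  have hker : ∀ x ∈ commutatorIdeal H, ψ x = 0 := by
    have : commutatorIdeal H ≤ RingHom.ker ψ := commutatorIdeal_le_iff.2 fun x y => by
      rw [RingHom.mem_ker, map_sub, map_mul, map_mul, mul_comm, sub_self]
    exact fun x hx => this hx
  refine ⟨Ideal.Quotient.lift _ ψ hker, ⟨?_, ?_⟩, ?_⟩
  · ext x
    obtain ⟨x, rfl⟩ := Ideal.Quotient.mk_surjective x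
    rw [Ideal.mem_comap, Ideal.Quotient.lift_mk, hψ.mem_iff, hπ.mem_iff]
  · rfl
  · rintro θ ⟨hθ, hθf⟩
    have := huniq (θ.comp (Ideal.Quotient.mk _)) ⟨hθ.comp hπ, hθf⟩
    refine Ideal.Quotient.ringHom_ext ?_
    rw [this]
    rfl

/-! ### Lift closed subrings and their size -/

/-- A subring `S` of `P` is lift closed if the inverses of the elements of `1 + M` and the coprime
monic factorizations modulo `M` stay in `S`. -/
structure IsLiftClosed {P : Type v} [Ring P] (M : Ideal P) [M.IsTwoSided] (S : Subring P) :
    Prop where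
  inv_mem : ∀ m ∈ S, m ∈ M → ∀ z, z * (1 + m) = 1 → z ∈ S
  coeff_mem : ∀ G₁ G₂ : P[X], G₁.Monic → G₂.Monic →
    IsLeftCoprime (G₁.map (Ideal.Quotient.mk M)) (G₂.map (Ideal.Quotient.mk M)) →
    (∀ n, (G₁ * G₂).coeff n ∈ S) → ∀ n, G₁.coeff n ∈ S ∧ G₂.coeff n ∈ S

/-- The inverses and factors are formed in the fixed ring `P`, so the conditions pass to
intersections. -/
theorem IsLiftClosed.sInf {P : Type v} [Ring P] {M : Ideal P} [M.IsTwoSided]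
    {𝒮 : Set (Subring P)} (h : ∀ S ∈ 𝒮, IsLiftClosed M S) : IsLiftClosed M (sInf 𝒮) := by
  constructor
  · intro m hm hmM z hz
    rw [Subring.mem_sInf] at hm ⊢
    exact fun S hS => (h S hS).inv_mem m (hm S hS) hmM z hz
  · intro G₁ G₂ h₁ h₂ hc hS n
    simp only [Subring.mem_sInf] at hS ⊢
    have key := fun S hSS => (h S hSS).coeff_mem G₁ G₂ h₁ h₂ hc (fun k => hS k S hSS) n
    exact ⟨fun S hSS => (key S hSS).1, fun S hSS => (key S hSS).2⟩

/-- The closure lies in the image of a free ring on a small copy of `s`. -/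
theorem Subring.small_closure {P : Type v} [Ring P] (s : Set P) [Small.{w} s] :
    Small.{w} (Subring.closure s) := by
  let f : FreeAlgebra ℤ (Shrink.{w} s) →ₐ[ℤ] P :=
    FreeAlgebra.lift ℤ fun x => ((equivShrink s).symm x : P)
  have hle : Subring.closure s ≤ f.toRingHom.range := by
    rw [Subring.closure_le]
    intro x hx
    exact ⟨FreeAlgebra.ι ℤ (equivShrink s ⟨x, hx⟩), by simp [f]⟩
  have : Small.{w} (Set.range f) := small_range f
  exact small_subset (s := Set.range f) hle

theorem small_setOf_exists_of_functional {ι : Type u} {P : Type v} [Small.{w} ι]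
    {r : ι → P → Prop} (hr : ∀ i z z', r i z → r i z' → z = z') :
    Small.{w} {z | ∃ i, r i z} := by
  choose f hf using fun z : {z | ∃ i, r i z} => z.2
  refine small_of_injective (f := f) fun z z' h => Subtype.ext (hr (f z) z z' (hf z) ?_)
  rw [h]
  exact hf z'

theorem IsLeftHenselian.eq_of_coeff_eq {P : Type v} [Ring P] {M : Ideal P} [M.IsTwoSided]
    (hM : IsLeftHenselian M) {G₁ G₂ G₁' G₂' : P[X]} (h₁ : G₁.Monic) (h₂ : G₂.Monic)
    (h₁' : G₁'.Monic) (h₂' : G₂'.Monic)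
    (hc : IsLeftCoprime (G₁.map (Ideal.Quotient.mk M)) (G₂.map (Ideal.Quotient.mk M)))
    (h : G₁ * G₂ = G₁' * G₂')
    (e₁ : G₁.map (Ideal.Quotient.mk M) = G₁'.map (Ideal.Quotient.mk M))
    (e₂ : G₂.map (Ideal.Quotient.mk M) = G₂'.map (Ideal.Quotient.mk M)) :
    (G₁, G₂) = (G₁', G₂') :=
  (hM.lift (G₁ * G₂) (h₁.mul h₂) _ _ (h₁.map _) (h₂.map _) hc
    (Polynomial.map_mul _)).unique ⟨h₁, h₂, rfl, rfl, rfl⟩ ⟨h₁', h₂', h, e₁.symm, e₂.symm⟩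

section SmallClosure

variable {P : Type v} [Ring P] (M : Ideal P) [M.IsTwoSided]

/-- `IsFactorCoeff M S i z`: `z` is the coefficient specified by `i` of a factor of a polynomial
with coefficients in `S`. -/
def IsFactorCoeff (S : Set P) (i : (ℕ → S) × (ℕ → P ⧸ M) × (ℕ → P ⧸ M) × ℕ × Bool) (z : P) :
    Prop :=
  ∃ G₁ G₂ : P[X], G₁.Monic ∧ G₂.Monic ∧
    IsLeftCoprime (G₁.map (Ideal.Quotient.mk M)) (G₂.map (Ideal.Quotient.mk M)) ∧
    (∀ n, (G₁ * G₂).coeff n = i.1 n) ∧ (∀ n, (G₁.map (Ideal.Quotient.mk M)).coeff n = i.2.1 n) ∧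
    (∀ n, (G₂.map (Ideal.Quotient.mk M)).coeff n = i.2.2.1 n) ∧
    z = bif i.2.2.2.2 then G₁.coeff i.2.2.2.1 else G₂.coeff i.2.2.2.1

/-- The subring generated by `S`, the inverses of the elements of `1 + S ∩ M`, and the
coefficients of the factors of polynomials over `S`. -/
def liftStep (S : Subring P) : Subring P :=
  Subring.closure ((S ∪ {z | ∃ m : S, (m : P) ∈ M ∧ z * (1 + m) = 1}) ∪
    {z | ∃ i, IsFactorCoeff M (S : Set P) i z})

variable {M}

theorem le_liftStep (S : Subring P) : S ≤ liftStep M S := fun _ hx =>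
  Subring.subset_closure (Or.inl (Or.inl hx))

theorem small_liftStep (hM : IsLeftHenselian M) [Small.{w} (P ⧸ M)] (S : Subring P)
    [Small.{w} S] : Small.{w} (liftStep M S) := by
  have : Small.{w} (S : Set P) := ‹Small.{w} S›
  have h1 : Small.{w} {z : P | ∃ m : S, (m : P) ∈ M ∧ z * (1 + m) = 1} :=
    small_setOf_exists_of_functional (r := fun (m : S) (z : P) => (m : P) ∈ M ∧ z * (1 + m) = 1)
      fun m z z' ⟨hm, hz⟩ ⟨_, hz'⟩ =>
        hM.jacobson.eq_of_mul_eq_one hm hz hz'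
  -- The product, the residues of both factors, the position and the choice of factor determine the
  -- coefficient, and such data form a small type.
  have h2 : Small.{w} {z | ∃ i, IsFactorCoeff M (S : Set P) i z} := by
    refine small_setOf_exists_of_functional fun i z z' hz hz' => ?_
    obtain ⟨G₁, G₂, m₁, m₂, hc, hG, e₁, e₂, rfl⟩ := hz
    obtain ⟨G₁', G₂', m₁', m₂', -, hG', e₁', e₂', rfl⟩ := hz'
    have := hM.eq_of_coeff_eq m₁ m₂ m₁' m₂' hc
      (Polynomial.ext fun n => (hG n).trans (hG' n).symm)
      (Polynomial.ext fun n => (e₁ n).trans (e₁' n).symm)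
      (Polynomial.ext fun n => (e₂ n).trans (e₂' n).symm)
    obtain ⟨rfl, rfl⟩ := Prod.mk.inj this
    rfl
  exact Subring.small_closure _

/-- Countably many steps suffice: a polynomial has finitely many nonzero coefficients, so they all
appear at one stage. -/
theorem exists_small_isLiftClosed (hM : IsLeftHenselian M) [Small.{w} (P ⧸ M)] (T : Set P)
    [Small.{w} T] : ∃ S : Subring P, T ⊆ S ∧ IsLiftClosed M S ∧ Small.{w} S := by
  let S : ℕ → Subring P := fun n => (liftStep M)^[n] (Subring.closure T)
  have hS : ∀ n, S (n + 1) = liftStep M (S n) := fun n => Function.iterate_succ_apply' _ _ _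
  have hmono : Monotone S := monotone_nat_of_le_succ fun n => by
    rw [hS]; exact le_liftStep _
  have hmem : ∀ {x}, x ∈ ⨆ n, S n ↔ ∃ n, x ∈ S n :=
    Subring.mem_iSup_of_directed hmono.directed_le
  have hsmall : ∀ n, Small.{w} (S n) := fun n => by
    induction n with
    | zero => exact Subring.small_closure T
    | succ n ih => rw [hS]; exact small_liftStep hM _
  refine ⟨⨆ n, S n, fun x hx => hmem.2 ⟨0, Subring.subset_closure hx⟩, ⟨?_, ?_⟩, ?_⟩
  · intro m hm hmM z hz
    obtain ⟨n, hn⟩ := hmem.1 hm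
    refine hmem.2 ⟨n + 1, ?_⟩
    rw [hS]
    exact Subring.subset_closure (Or.inl (Or.inr ⟨⟨m, hn⟩, hmM, hz⟩))
  · intro G₁ G₂ m₁ m₂ hc hG
    choose N hN using fun k => hmem.1 (hG k)
    have hcoeff : ∀ k, (G₁ * G₂).coeff k ∈ S ((Finset.range ((G₁ * G₂).natDegree + 1)).sup N) := by
      intro k
      by_cases hk : k ∈ Finset.range ((G₁ * G₂).natDegree + 1)
      · exact hmono (Finset.le_sup hk) (hN k)
      · rw [coeff_eq_zero_of_natDegree_lt (by simpa using hk)]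
        exact Subring.zero_mem _
    generalize (Finset.range ((G₁ * G₂).natDegree + 1)).sup N = k at hcoeff
    have key : ∀ n b, (bif b then G₁.coeff n else G₂.coeff n) ∈ S (k + 1) := fun n b => by
      rw [hS]
      exact Subring.subset_closure (Or.inr ⟨(fun j => ⟨_, hcoeff j⟩, fun j => _, fun j => _, n, b),
        G₁, G₂, m₁, m₂, hc, fun _ => rfl, fun _ => rfl, fun _ => rfl, rfl⟩)
    exact fun n => ⟨hmem.2 ⟨k + 1, key n true⟩, hmem.2 ⟨k + 1, key n false⟩⟩
  · have : Small.{w} (⋃ n, (S n : Set P)) :=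
      @small_iUnion _ _ _ _ fun n => hsmall n
    rw [← Subring.coe_iSup_of_directed hmono.directed_le] at this
    exact this

end SmallClosure

/-! ### Left Henselian subrings and uniqueness of maps -/

theorem Polynomial.exists_map_eq_of_coeff_mem_range {R : Type u} {P : Type v} [Ring R] [Ring P]
    {g : R →+* P} {G : P[X]} (h : ∀ n, G.coeff n ∈ g.range) : ∃ F : R[X], F.map g = G := by
  rw [← Polynomial.mem_lifts, Polynomial.lifts_iff_coeff_lifts]
  exact h

/-- A lift closed subring of a left Henselian pair is left Henselian. -/
theorem IsLeftHenselian.comap_of_isLiftClosed {R : Type u} {P : Type v} [Ring R] [Ring P]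
    {M : Ideal P} [M.IsTwoSided] (hM : IsLeftHenselian M) {g : R →+* P}
    (hg : Function.Injective g) (hcl : IsLiftClosed M g.range) :
    IsLeftHenselian (M.comap g) := by
  have hpair : IsPairHom (M.comap g) M g := rfl
  refine IsLeftHenselian.of_jointly_injective (ι := Unit) (g := fun _ => g) (L := fun _ => M)
    (fun _ => hpair) (fun x y h => hg (h ())) (fun _ => hM) ?_ ?_
  · refine isJacobsonPair_iff.2 fun x hx => ?_
    obtain ⟨z, hz⟩ := isJacobsonPair_iff.1 hM.jacobson (g x) hx
    obtain ⟨z, rfl⟩ := hcl.inv_mem (g x) ⟨x, rfl⟩ hx z hz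
    exact ⟨z, hg (by rw [map_mul, map_add, map_one, hz])⟩
  · intro F hF f₁ f₂ h₁ h₂ hc hf
    obtain ⟨⟨P₁, P₂⟩, hP, -⟩ := hM.existsUnique_isMonicLift_map hpair hF h₁ h₂ hc hf
    have hcoeff := hcl.coeff_mem P₁ P₂ hP.1 hP.2.1
      (by rw [hP.2.2.2.1, hP.2.2.2.2]; exact hc.map _)
      fun n => by
        rw [← hP.2.2.1, Polynomial.coeff_map]
        exact ⟨_, rfl⟩
    obtain ⟨G₁, rfl⟩ := Polynomial.exists_map_eq_of_coeff_mem_range fun n => (hcoeff n).1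
    obtain ⟨G₂, rfl⟩ := Polynomial.exists_map_eq_of_coeff_mem_range fun n => (hcoeff n).2
    exact ⟨G₁, G₂, fun _ => hP⟩

/-- Two morphisms to a left Henselian pair from the smallest lift closed subring containing the
image of `A` agree if they agree on `A`. -/
theorem IsPairHom.eq_of_comp_eq {A : Type u} {H : Type u} {B : Type u} {P : Type v} [Ring A]
    [Ring H] [Ring B] [Ring P] {M : Ideal P} [M.IsTwoSided] {g : H →+* P}
    (hg : Function.Injective g) {φ : A →+* H} (hsurj : ∀ p, ∃ a, p - g (φ a) ∈ M)
    (hcl : IsLiftClosed M g.range)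
    (hmin : ∀ S, IsLiftClosed M S → (g.comp φ).range ≤ S → g.range ≤ S)
    {L : Ideal B} [L.IsTwoSided] (hL : IsLeftHenselian L) {ψ₁ ψ₂ : H →+* B}
    (h₁ : IsPairHom (M.comap g) L ψ₁) (h₂ : IsPairHom (M.comap g) L ψ₂)
    (h : ψ₁.comp φ = ψ₂.comp φ) : ψ₁ = ψ₂ := by
  have hpair : IsPairHom (M.comap g) M g := rfl
  have hφ : ∀ x : H, ∃ a, x - φ a ∈ M.comap g := fun x => by
    obtain ⟨a, ha⟩ := hsurj (g x)
    exact ⟨a, by rwa [Ideal.mem_comap, map_sub]⟩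
  -- Every element of `H` is congruent to one coming from `A`.
  have hres : h₁.residueMap = h₂.residueMap := by
    refine Ideal.Quotient.ringHom_ext (RingHom.ext fun x => ?_)
    obtain ⟨a, ha⟩ := hφ x
    rw [RingHom.comp_apply, RingHom.comp_apply, Ideal.Quotient.eq.2 ha, h₁.residueMap_mk,
      h₂.residueMap_mk]
    exact congrArg _ (RingHom.congr_fun h a)
  -- Used to bring left coprimality back from `P ⧸ M` to the residue ring of `H`.
  let e : H ⧸ M.comap g ≃+* P ⧸ M := RingEquiv.ofBijective hpair.residueMap
    ⟨hpair.residueMap_injective, fun y => by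
      obtain ⟨p, rfl⟩ := Ideal.Quotient.mk_surjective y
      obtain ⟨a, ha⟩ := hsurj p
      exact ⟨Ideal.Quotient.mk _ (φ a), (Ideal.Quotient.eq.2 ha).symm⟩⟩
  have he : ∀ f : (H ⧸ M.comap g)[X], (f.map hpair.residueMap).map e.symm.toRingHom = f :=
    fun f => by
      have : e.symm.toRingHom.comp hpair.residueMap = RingHom.id _ :=
        RingHom.ext fun x => e.symm_apply_apply x
      rw [Polynomial.map_map, this, Polynomial.map_id]
  -- The equalizer, viewed in `P`. Uniqueness of lifts in `B` makes it lift closed, so by minimality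
  -- it is everything.
  let T : Subring P := (RingHom.eqLocus ψ₁ ψ₂).map g
  have hTmem : ∀ {x}, g x ∈ T ↔ ψ₁ x = ψ₂ x := fun {x} =>
    ⟨by rintro ⟨y, hy, hyx⟩; exact hg hyx ▸ hy, fun hx => ⟨x, hx, rfl⟩⟩
  have hTle : T ≤ g.range := by rintro _ ⟨y, -, rfl⟩; exact ⟨y, rfl⟩
  have hT : IsLiftClosed M T := by
    constructor
    · intro m hm hmM z hz
      obtain ⟨z, rfl⟩ := hcl.inv_mem m (hTle hm) hmM z hz
      obtain ⟨x, hx, rfl⟩ := hm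
      have hzx : z * (1 + x) = 1 := hg (by rw [map_mul, map_add, map_one, hz])
      refine hTmem.2 (hL.jacobson.eq_of_mul_eq_one (h₁.mem_iff.2 hmM) ?_ ?_)
      · rw [← map_one ψ₁, ← map_add, ← map_mul, hzx]
      · rw [show ψ₁ x = ψ₂ x from hx, ← map_one ψ₂, ← map_add, ← map_mul, hzx]
    · intro G₁ G₂ m₁ m₂ hc hG
      have hcoeff := hcl.coeff_mem G₁ G₂ m₁ m₂ hc fun n => hTle (hG n)
      obtain ⟨F₁, rfl⟩ := Polynomial.exists_map_eq_of_coeff_mem_range fun n => (hcoeff n).1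
      obtain ⟨F₂, rfl⟩ := Polynomial.exists_map_eq_of_coeff_mem_range fun n => (hcoeff n).2
      have n₁ := Polynomial.monic_of_injective hg m₁
      have n₂ := Polynomial.monic_of_injective hg m₂
      have hc' : IsLeftCoprime (F₁.map (Ideal.Quotient.mk (M.comap g)))
          (F₂.map (Ideal.Quotient.mk (M.comap g))) := by
        rw [← he (F₁.map _), ← he (F₂.map _), hpair.map_residueMap, hpair.map_residueMap]
        exact hc.map _
      have hmul : F₁.map ψ₁ * F₂.map ψ₁ = F₁.map ψ₂ * F₂.map ψ₂ := by
        rw [← Polynomial.map_mul, ← Polynomial.map_mul]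
        ext n
        rw [Polynomial.coeff_map, Polynomial.coeff_map]
        refine hTmem.1 ?_
        rw [← Polynomial.coeff_map, Polynomial.map_mul]
        exact hG n
      have hred : ∀ F : H[X], (F.map ψ₁).map (Ideal.Quotient.mk L) =
          (F.map ψ₂).map (Ideal.Quotient.mk L) := fun F => by
        rw [← h₁.map_residueMap, ← h₂.map_residueMap, hres]
      have key := hL.eq_of_coeff_eq (n₁.map ψ₁) (n₂.map ψ₁) (n₁.map ψ₂) (n₂.map ψ₂)
        (by rw [← h₁.map_residueMap, ← h₁.map_residueMap]; exact hc'.map _) hmul (hred _) (hred _)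
      obtain ⟨k₁, k₂⟩ := Prod.mk.inj key
      intro n
      rw [Polynomial.coeff_map, Polynomial.coeff_map, hTmem, hTmem, ← Polynomial.coeff_map,
        ← Polynomial.coeff_map, ← Polynomial.coeff_map, ← Polynomial.coeff_map, k₁, k₂]
      exact ⟨rfl, rfl⟩
  have hrange := hmin T hT (by
    rintro _ ⟨a, rfl⟩
    exact hTmem.2 (RingHom.congr_fun h a))
  exact RingHom.ext fun x => hTmem.1 (hrange ⟨x, rfl⟩)

/-! ### The fibre product of all test pairs -/

/-- The perfect left Henselian pairs under `(A, I)`. -/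
structure PerfectHenselianUnder {A : Type u} [Ring A] (I : Ideal A) : Type (u + 1) where
  carrier : Type u
  [ring : Ring carrier]
  ideal : Ideal carrier
  [isTwoSided : ideal.IsTwoSided]
  hom : A →+* carrier
  perfect : IsPerfectPair ideal
  henselian : IsLeftHenselian ideal
  isPairHom : IsPairHom I ideal hom

namespace PerfectHenselianUnder

attribute [instance] ring isTwoSided

/-- The only place where existence uses commutativity of `A`: it makes `(A ⧸ I, 0)` perfect. -/
instance {A : Type u} [CommRing A] (I : Ideal A) : Nonempty (PerfectHenselianUnder I) :=
  ⟨{ carrier := A ⧸ I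
     ideal := ⊥
     hom := Ideal.Quotient.mk I
     perfect := isPerfectPair_of_comm mul_comm _
     henselian := isLeftHenselian_bot _
     isPairHom := isPairHom_mk_bot I }⟩

variable {A : Type u} [Ring A] (I : Ideal A)

/-- The fibre product over `A ⧸ I` of all perfect left Henselian pairs under `(A, I)`. -/
def product : Subring (∀ c : PerfectHenselianUnder I, c.carrier) where
  carrier := {x | ∃ a, ∀ c, x c - c.hom a ∈ c.ideal}
  mul_mem' := by
    rintro x y ⟨a, ha⟩ ⟨b, hb⟩
    refine ⟨a * b, fun c => ?_⟩
    have : (x * y) c - c.hom (a * b) = (x c - c.hom a) * y c + c.hom a * (y c - c.hom b) := by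
      rw [map_mul, Pi.mul_apply]; noncomm_ring
    rw [this]
    exact add_mem (Ideal.mul_mem_right _ _ (ha c)) (Ideal.mul_mem_left _ _ (hb c))
  one_mem' := ⟨1, fun c => by simp⟩
  add_mem' := by
    rintro x y ⟨a, ha⟩ ⟨b, hb⟩
    refine ⟨a + b, fun c => ?_⟩
    rw [map_add, Pi.add_apply, add_sub_add_comm]
    exact add_mem (ha c) (hb c)
  zero_mem' := ⟨0, fun c => by simp⟩
  neg_mem' := by
    rintro x ⟨a, ha⟩
    refine ⟨-a, fun c => ?_⟩
    rw [map_neg, Pi.neg_apply, ← neg_sub']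
    exact neg_mem (ha c)

variable {I}

/-- The projections of the fibre product. -/
def proj (c : PerfectHenselianUnder I) : product I →+* c.carrier :=
  (Pi.evalRingHom _ c).comp (product I).subtype

theorem proj_jointly_injective (x y : product I) (h : ∀ c, proj c x = proj c y) : x = y :=
  Subtype.ext (funext h)

theorem exists_proj_eq {x : ∀ c : PerfectHenselianUnder I, c.carrier} {a : A}
    (h : ∀ c, x c - c.hom a ∈ c.ideal) : ∃ y : product I, ∀ c, proj c y = x c :=
  ⟨⟨x, a, h⟩, fun _ => rfl⟩

theorem exists_proj_sub_mem (x : product I) : ∃ a, ∀ c, proj c x - c.hom a ∈ c.ideal :=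
  x.2

variable (I) in
/-- The ideal of the fibre product. -/
def productIdeal : Ideal (product I) := ⨅ c : PerfectHenselianUnder I, c.ideal.comap (proj c)

theorem mem_productIdeal {x : product I} : x ∈ productIdeal I ↔ ∀ c, proj c x ∈ c.ideal :=
  Ideal.mem_iInf

instance : (productIdeal I).IsTwoSided :=
  ⟨fun b ha => mem_productIdeal.2 fun c => by
    rw [map_mul]; exact Ideal.mul_mem_right _ _ (mem_productIdeal.1 ha c)⟩

/-- All components of `x` are congruent to images of a single `a`; if one lies in its ideal then `a
∈ I`, and hence all do. -/
theorem isPairHom_proj (c : PerfectHenselianUnder I) :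
    IsPairHom (productIdeal I) c.ideal (proj c) := by
  ext x
  rw [Ideal.mem_comap, mem_productIdeal]
  refine ⟨fun h c' => ?_, fun h => h c⟩
  obtain ⟨a, ha⟩ := exists_proj_sub_mem x
  have h1 : a ∈ I := c.isPairHom.mem_iff.1 ((Submodule.sub_mem_iff_right _ h).1 (ha c))
  exact (Submodule.sub_mem_iff_left _ (c'.isPairHom.mem_iff.2 h1)).1 (ha c')

variable (I) in
/-- The structure map of the fibre product. -/
def toProduct : A →+* product I where
  toFun a := ⟨fun c => c.hom a, a, fun c => by simp⟩
  map_one' := Subtype.ext (funext fun c => map_one c.hom)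
  map_mul' a b := Subtype.ext (funext fun c => map_mul c.hom a b)
  map_zero' := Subtype.ext (funext fun c => map_zero c.hom)
  map_add' a b := Subtype.ext (funext fun c => map_add c.hom a b)

theorem proj_comp_toProduct (c : PerfectHenselianUnder I) : (proj c).comp (toProduct I) = c.hom :=
  rfl

theorem exists_sub_toProduct_mem (x : product I) : ∃ a, x - toProduct I a ∈ productIdeal I := by
  obtain ⟨a, ha⟩ := exists_proj_sub_mem x
  exact ⟨a, mem_productIdeal.2 fun c => by rw [map_sub]; exact ha c⟩

theorem isPerfectPair_productIdeal : IsPerfectPair (productIdeal I) :=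
  IsPerfectPair.of_jointly_injective isPairHom_proj proj_jointly_injective fun c => c.perfect

theorem isJacobsonPair_productIdeal : IsJacobsonPair (productIdeal I) := by
  refine isJacobsonPair_iff.2 fun x hx => ?_
  choose z hz using fun c : PerfectHenselianUnder I =>
    isJacobsonPair_iff.1 c.henselian.jacobson (proj c x) (mem_productIdeal.1 hx c)
  -- Each inverse is `1` minus an element of the ideal, so the family has common residue `1`.
  obtain ⟨y, hy⟩ := exists_proj_eq (x := z) (a := 1) fun c => by
    have : z c - c.hom 1 = -(z c * proj c x) := by
      rw [map_one, ← hz c]; noncomm_ring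
    rw [this]
    exact neg_mem (Ideal.mul_mem_left _ _ (mem_productIdeal.1 hx c))
  refine ⟨y, proj_jointly_injective _ _ fun c => ?_⟩
  rw [map_mul, hy, map_add, map_one, hz c]

/-- A family of polynomials with compatible reductions comes from the fibre product. -/
theorem exists_map_proj_eq {f : (product I ⧸ productIdeal I)[X]}
    {G : ∀ c : PerfectHenselianUnder I, c.carrier[X]} (hG : ∀ c, (G c).Monic)
    (h : ∀ c, (G c).map (Ideal.Quotient.mk c.ideal) = f.map (isPairHom_proj c).residueMap) :
    ∃ F : (product I)[X], ∀ c, F.map (proj c) = G c := by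
  have hcoeff : ∀ n, ∃ y : product I, ∀ c, proj c y = (G c).coeff n := fun n => by
    obtain ⟨p, hp⟩ := Ideal.Quotient.mk_surjective (f.coeff n)
    obtain ⟨a, ha⟩ := exists_proj_sub_mem p
    refine exists_proj_eq (a := a) fun c => ?_
    rw [← Ideal.Quotient.eq, ← Polynomial.coeff_map, h, Polynomial.coeff_map, ← hp,
      IsPairHom.residueMap_mk, Ideal.Quotient.eq]
    exact ha c
  choose y hy using hcoeff
  refine ⟨∑ n ∈ Finset.range (f.natDegree + 1), monomial n (y n), fun c => ?_⟩
  -- The degree of `f` bounds all components at once, so one finite sum serves them all.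
  have hd : (G c).natDegree < f.natDegree + 1 := by
    rw [← c.henselian.jacobson.natDegree_map_mk (hG c), h, Nat.lt_succ_iff]
    exact natDegree_map_le
  rw [Polynomial.map_sum, as_sum_range' (G c) _ hd]
  exact Finset.sum_congr rfl fun n _ => by rw [Polynomial.map_monomial, hy]

theorem isLeftHenselian_productIdeal [Nonempty (PerfectHenselianUnder I)] :
    IsLeftHenselian (productIdeal I) := by
  refine IsLeftHenselian.of_jointly_injective isPairHom_proj proj_jointly_injective
    (fun c => c.henselian) isJacobsonPair_productIdeal fun F hF f₁ f₂ h₁ h₂ hc hf => ?_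
  choose P hP _ using fun c : PerfectHenselianUnder I =>
    c.henselian.existsUnique_isMonicLift_map (isPairHom_proj c) hF h₁ h₂ hc hf
  obtain ⟨G₁, hG₁⟩ := exists_map_proj_eq (fun c => (hP c).1) fun c => (hP c).2.2.2.1
  obtain ⟨G₂, hG₂⟩ := exists_map_proj_eq (fun c => (hP c).2.1) fun c => (hP c).2.2.2.2
  exact ⟨G₁, G₂, fun c => by rw [hG₁, hG₂]; exact hP c⟩

end PerfectHenselianUnder

/-! ### Existence of the left Henselization -/

open PerfectHenselianUnder

theorem Subring.exists_injective_range_eq {P : Type v} [Ring P] (S : Subring P) [Small.{w} S] :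
    ∃ (H : Type w) (_ : Ring H) (g : H →+* P), Function.Injective g ∧ g.range = S := by
  refine ⟨Shrink.{w} S, inferInstance,
    S.subtype.comp (Shrink.ringEquiv S : Shrink.{w} S →+* S), ?_, ?_⟩
  · exact Subtype.val_injective.comp (Shrink.ringEquiv S).injective
  · ext x
    constructor
    · rintro ⟨y, rfl⟩
      exact ((Shrink.ringEquiv S) y).2
    · exact fun hx => ⟨(Shrink.ringEquiv S).symm ⟨x, hx⟩, by simp⟩

theorem RingHom.exists_comp_eq_of_range_le {A : Type u} {H : Type w} {P : Type v} [Ring A]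
    [Ring H] [Ring P] {g : H →+* P} (hg : Function.Injective g) {i : A →+* P}
    (h : i.range ≤ g.range) : ∃ φ : A →+* H, g.comp φ = i := by
  let e : H ≃+* g.range := RingEquiv.ofBijective g.rangeRestrict
    ⟨fun x y hxy => hg (congrArg Subtype.val hxy), g.rangeRestrict_surjective⟩
  refine ⟨(e.symm : g.range →+* H).comp (i.codRestrict g.range fun a => h ⟨a, rfl⟩), ?_⟩
  ext a
  exact congrArg Subtype.val (e.apply_symm_apply ⟨i a, h ⟨a, rfl⟩⟩)

/-- Existence of left Henselizations. -/
theorem exists_isLeftHenselization {A : Type u} [Ring A] (I : Ideal A) [I.IsTwoSided]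
    [Nonempty (PerfectHenselianUnder I)] :
    ∃ (H : Type u) (_ : Ring H) (K : Ideal H) (_ : K.IsTwoSided) (φ : A →+* H),
      IsLeftHenselization I K φ := by
  let 𝒮 : Set (Subring (product I)) :=
    {S | (toProduct I).range ≤ S ∧ IsLiftClosed (productIdeal I) S}
  have hM := isLeftHenselian_productIdeal (I := I)
  -- The residue ring is an image of `A`, so some small lift closed subring contains the image of
  -- `A`, and the infimum lies inside it.
  have hsmall : Small.{u} (sInf 𝒮 : Subring (product I)) := by
    have h1 : Small.{u} (product I ⧸ productIdeal I) :=
      small_of_surjective (f := fun a : A => Ideal.Quotient.mk (productIdeal I) (toProduct I a))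
        fun y => by
          obtain ⟨x, rfl⟩ := Ideal.Quotient.mk_surjective y
          obtain ⟨a, ha⟩ := exists_sub_toProduct_mem x
          exact ⟨a, (Ideal.Quotient.eq.2 ha).symm⟩
    have h2 : Small.{u} (Set.range (toProduct I)) := small_range _
    obtain ⟨S, hTS, hS, hSs⟩ := exists_small_isLiftClosed hM (Set.range (toProduct I))
    have hle : sInf 𝒮 ≤ S := sInf_le ⟨hTS, hS⟩
    exact small_subset (s := (S : Set (product I))) hle
  obtain ⟨H, _, g, hg, hrange⟩ := (sInf 𝒮).exists_injective_range_eq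
  have hle : (toProduct I).range ≤ g.range := by
    rw [hrange]; exact le_sInf fun S hS => hS.1
  have hcl : IsLiftClosed (productIdeal I) g.range := by
    rw [hrange]; exact IsLiftClosed.sInf fun S hS => hS.2
  obtain ⟨φ, hφ⟩ := RingHom.exists_comp_eq_of_range_le hg hle
  have hpair : IsPairHom ((productIdeal I).comap g) (productIdeal I) g := rfl
  have hproj : ∀ c : PerfectHenselianUnder I, ((proj c).comp g).comp φ = c.hom := fun c => by
    rw [RingHom.comp_assoc, hφ, proj_comp_toProduct]
  have hφI : IsPairHom I ((productIdeal I).comap g) φ := by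
    let c : PerfectHenselianUnder I := Classical.arbitrary _
    rw [IsPairHom, ← (isPairHom_proj c).comp hpair, Ideal.comap_comap, hproj]
    exact c.isPairHom
  refine ⟨H, inferInstance, (productIdeal I).comap g, inferInstance, φ, ?_, ?_, hφI, ?_⟩
  · exact IsPerfectPair.of_jointly_injective (ι := Unit) (g := fun _ => g)
      (fun _ => hpair) (fun x y h => hg (h ())) fun _ => isPerfectPair_productIdeal
  · exact hM.comap_of_isLiftClosed hg hcl
  · intro B _ L _ f hLp hLh hf
    -- The test pair is itself a factor of the product, so its projection is the required map.
    let c : PerfectHenselianUnder I := ⟨B, L, f, hLp, hLh, hf⟩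
    refine ⟨(proj c).comp g, ⟨(isPairHom_proj c).comp hpair, (hproj c).symm⟩, ?_⟩
    rintro ψ ⟨hψ, hψf⟩
    refine IsPairHom.eq_of_comp_eq hg (φ := φ) ?_ hcl ?_ hLh hψ
      ((isPairHom_proj c).comp hpair) (hψf.symm.trans (hproj c).symm)
    · intro p
      obtain ⟨a, ha⟩ := exists_sub_toProduct_mem p
      exact ⟨a, by rwa [← RingHom.comp_apply, hφ]⟩
    · intro S hS hSle
      rw [hφ] at hSle
      rw [hrange]
      exact sInf_le ⟨hSle, hS⟩

theorem mainTheorem5 {A : Type u} [CommRing A] (I : Ideal A) :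
    (∃ (H : Type u) (_ : Ring H) (K : Ideal H) (_ : K.IsTwoSided) (φ : A →+* H),
      IsLeftHenselization I K φ) ∧
    ∀ (H : Type u) [Ring H] (K : Ideal H) [K.IsTwoSided] (φ : A →+* H),
      IsLeftHenselization I K φ →
        commutatorIdeal H ≤ K ∧
        IsPairHom K (quotientIdeal K (commutatorIdeal H))
          (Ideal.Quotient.mk (commutatorIdeal H)) ∧
        IsCommutativeHenselization I (quotientIdeal K (commutatorIdeal H))
          ((Ideal.Quotient.mk (commutatorIdeal H)).comp φ) :=
  ⟨exists_isLeftHenselization I, fun _ _ _ _ _ h => ⟨h.commutatorIdeal_le,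
    isPairHom_mk_quotientIdeal h.commutatorIdeal_le, h.isCommutativeHenselization⟩⟩
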